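/- **Setting.** Let $X=\mathbb R^d$ with the Euclidean metric and write $B(x,r)=\{y:|y-x|<r\}$. Let $\mathcal W$ be a convex cone of lower semicontinuous functions $X\to[0,\infty]$ with $1\in\mathcal W$ such that $(X,\mathcal W)$ is a balayage space, that is: * $\mathcal W$ separates points; every $w\in\mathcal W$ is the pointwise supremum of $\{v\in\mathcal W : v \text{ continuous and real},\ v\le w\}$; and there are strictly positive continuous real $u,v\in\mathcal W$ with $u/v\to0$ at infinity; * $\sup_n v_n\in\mathcal W$ for every increasing sequence $(v_n)$ in $\mathcal W$; * for every $\mathcal V\subset\mathcal W$, the greatest finely lower semicontinuous minorant of $\inf\mathcal V$ is in $\mathcal W$ (the fine topology is the coarsest topology, at least as fine as the initial one, making all functions of $\mathcal W$ continuous); * if $u,v',v''\in\mathcal W$ and $u\le v'+v''$, then $u=u'+u''$ with $u',u''\in\mathcal W$, $u'\le v'$, $u''\le v''$. For $A\subset X$ and $u\in\mathcal W$ let $R_u^A=\inf\{v\in\mathcal W: v\ge u\text{ on }A\}$, and let $\varepsilon_x^A$ be the reduced measure, i.e. the measure with $\int u\,d\varepsilon_x^A=R_u^A(x)$ for all $u\in\mathcal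 W$. A Borel function $h\ge0$ on $X$ is harmonic on an open set $U$ if $h|_U$ is continuous and real and $\int h\,d\varepsilon_x^{V^c}=h(x)$ whenever $V$ is open with compact closure in $U$ and $x\in V$. A potential is a function $p\in\mathcal W$ such that, for every relatively compact open $V$, $R_p^{V^c}$ is continuous and real on $V$, and the pointwise infimum of these functions $R_p^{V^c}$ is $0$. Let $G:X\times X\to(0,\infty]$ be Borel with $G=\infty$ on the diagonal, such that every $G(\cdot,y)$ is a potential that is harmonic on $X\setminus\{y\}$, and every potential $p$ is of the form $p=\int G(\cdot,y)\,d\mu(y)$ for some measure $\mu$. Let $g:[0,\infty)\to(0,\infty]$ be decreasing, and let $c\ge1$, $c_D>1$, $\alpha_0,\eta_0\in(0,1)$, $0<R_0\le\infty$ be such that $$c^{-1}g(|x-y|)\le G(x,y)\le c\,g(|x-y|)\quad(x,y\in X),$$ $$g(r/2)\le c_D\,g(r),\qquad g(r)\le\eta_0\,g(\alpha_0r)\qquad(0<r<R_0).$$ For open $V$ and $y\in V$ put $G_V(\cdot,y)=G(\cdot,y)-R_{G(\cdot,y)}^{V^c}$. Let $\lambda$ be Lebesgue measure on $X$, and let $N$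 be a kernel on $X$, $M_N\ge3$ and $C_N\ge1$ such that, for all $x\in X$ and $0<r<R_0$, $$C_N^{-1}\varepsilon_x^{B(x,r)^c}\le\int_{B(x,r)}G_{B(x,r)}(x,z)\,N(z,\cdot)\,d\lambda(z)\le C_N\,\varepsilon_x^{B(x,r)^c}\quad\text{on }B(x,M_Nr)^c .$$ Assume also that there is $C_G\ge1$ such that, for all $x\in X$ and $0<r<R_0$, $$\frac1{\lambda(B(x,r))}\int_{B(x,r)}G(w,z)\,d\lambda(z)\le C_G\,g(r)\qquad(w\in X).$$ **Proposition.** Suppose that there exist a measure $\tilde\lambda$ on $\mathbb R^d$, a function $n:\mathbb R^d\times\mathbb R^d\to[0,\infty)$ with each $n(y,\cdot)$ Borel, and constants $C\ge1$, $a\ge3$ such that $N(y,\cdot)=n(y,\cdot)\,\tilde\lambda$ for every $y\in X$ and, for all $x\in X$, $0<r<R_0$, $y\in B(x,r)$ and $\tilde z\in B(x,ar)^c$, $$n(x,\tilde z)\le C\,n(y,\tilde z)\qquad\text{provided }|x-\tilde z|\ge|y-\tilde z| .$$ Then there exist $0<R_1\le\infty$, $c_J>0$ and $0<\alpha<\tfrac12$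 such that, for all $x\in X$, $0<r<R_1$ and $y\in B(x,\alpha r)$, $$\varepsilon_x^{B(x,\alpha r)^c}\le c_J\,\varepsilon_y^{B(y,r)^c}\quad\text{on }B(y,r)^c .$$ -/

import Mathlib

open MeasureTheory Set Filter Topology
open scoped NNReal ENNReal

namespace Balayage

section Cone

variable {X : Type*} [TopologicalSpace X]

/-- The `W`-fine topology: the coarsest topology that is at least as fine as the given one and
makes every function of `W` continuous. -/
abbrev fineTopology (W : Set (X → ℝ≥0∞)) : TopologicalSpace X :=
  (inferInstance : TopologicalSpace X) ⊓
    ⨅ w ∈ W, TopologicalSpace.induced w (inferInstance : TopologicalSpace ℝ≥0∞)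

/-- The greatest finely lower semicontinuous minorant of `f`. -/
noncomputable def fineLscReg (W : Set (X → ℝ≥0∞)) (f : X → ℝ≥0∞) : X → ℝ≥0∞ :=
  fun x => ⨆ φ ∈ {φ : X → ℝ≥0∞ | φ ≤ f ∧ @LowerSemicontinuous X ℝ≥0∞ (fineTopology W) _ φ}, φ x

/-- `W ∩ C(X)`: the continuous real-valued members of `W`. -/
def contPart (W : Set (X → ℝ≥0∞)) : Set (X → ℝ≥0∞) :=
  {v | v ∈ W ∧ Continuous v ∧ ∀ x, v x ≠ ∞}

/-- `(X, W)` is a balayage space with `1 ∈ W`. As `1 ∈ W`, separating points and linearly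
separating points are the same for `W`. -/
structure IsBalayageSpace (W : Set (X → ℝ≥0∞)) : Prop where
  lsc : ∀ w ∈ W, LowerSemicontinuous w
  add_mem : ∀ u ∈ W, ∀ v ∈ W, u + v ∈ W
  smul_mem : ∀ (a : ℝ≥0), ∀ u ∈ W, (fun x => (a : ℝ≥0∞) * u x) ∈ W
  one_mem : (fun _ => 1) ∈ W
  separates : ∀ x y, x ≠ y → ∃ w ∈ W, w x ≠ w y
  eq_iSup_cont : ∀ w ∈ W, ∀ x, w x = ⨆ v ∈ {v ∈ contPart W | v ≤ w}, v x
  exists_div_tendsto : ∃ u ∈ contPart W, ∃ v ∈ contPart W, (∀ x, 0 < u x) ∧ (∀ x, 0 < v x) ∧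
    Tendsto (fun x => u x / v x) (cocompact X) (𝓝 0)
  iSup_mem : ∀ v : ℕ → X → ℝ≥0∞, (∀ n, v n ∈ W) → Monotone v → (fun x => ⨆ n, v n x) ∈ W
  fineLscReg_iInf_mem : ∀ V ⊆ W, fineLscReg W (fun x => ⨅ v ∈ V, v x) ∈ W
  decomposition : ∀ u ∈ W, ∀ v₁ ∈ W, ∀ v₂ ∈ W, u ≤ v₁ + v₂ →
    ∃ u₁ ∈ W, ∃ u₂ ∈ W, u = u₁ + u₂ ∧ u₁ ≤ v₁ ∧ u₂ ≤ v₂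

/-- The reduced function `R_u^A = inf {v ∈ W : v ≥ u on A}`. -/
noncomputable def reduced (W : Set (X → ℝ≥0∞)) (u : X → ℝ≥0∞) (A : Set X) : X → ℝ≥0∞ :=
  fun x => ⨅ v ∈ {v ∈ W | ∀ a ∈ A, u a ≤ v a}, v x

/-- `p ∈ W` is a potential: for every relatively compact open `V`, the function `R_p^{Vᶜ}` is
continuous and real on `V`, and the (pointwise) infimum of these functions is zero. -/
structure IsPotential (W : Set (X → ℝ≥0∞)) (p : X → ℝ≥0∞) : Prop where
  mem : p ∈ W
  continuousOn : ∀ V : Set X, IsOpen V → IsCompact (closure V) → ContinuousOn (reduced W p Vᶜ) V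
  ne_top : ∀ V : Set X, IsOpen V → IsCompact (closure V) → ∀ x ∈ V, reduced W p Vᶜ x ≠ ∞
  iInf_eq_zero : ∀ x, ⨅ V ∈ {V : Set X | IsOpen V ∧ IsCompact (closure V)}, reduced W p Vᶜ x = 0

/-- The Green function `G_V(·, y) = G(·, y) - R_{G(·, y)}^{Vᶜ}` of an open set `V`, for `y ∈ V`. -/
noncomputable def greenOn (W : Set (X → ℝ≥0∞)) (G : X → X → ℝ≥0∞) (V : Set X) (x y : X) : ℝ≥0∞ :=
  G x y - reduced W (fun z => G z y) Vᶜ x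

variable [MeasurableSpace X]

open Classical in
/-- The reduced measure `ε_x^A`: the measure with `∫ u dε_x^A = R_u^A(x)` for all `u ∈ W`. -/
noncomputable def reducedMeasure (W : Set (X → ℝ≥0∞)) (x : X) (A : Set X) : Measure X :=
  if h : ∃ μ : Measure X, ∀ u ∈ W, ∫⁻ z, u z ∂μ = reduced W u A x then h.choose else 0

/-- `h ∈ H⁺(U)`: `h` is a positive Borel function on `X` which is harmonic on `U`. -/
structure IsHarmonicOn (W : Set (X → ℝ≥0∞)) (U : Set X) (h : X → ℝ≥0∞) : Prop where
  measurable : Measurable h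
  continuousOn : ContinuousOn h U
  ne_top : ∀ x ∈ U, h x ≠ ∞
  mean_value : ∀ V : Set X, IsOpen V → IsCompact (closure V) → closure V ⊆ U →
    ∀ x ∈ V, ∫⁻ z, h z ∂(reducedMeasure W x Vᶜ) = h x

end Cone

section Metric

variable {X : Type*} [MetricSpace X] [MeasurableSpace X]

/-- `G` is a Green function for `(X, W)` that is comparable with `g ∘ ρ`, where `ρ` is the metric
of `X` and the decreasing function `g : [0, ∞) → (0, ∞]` has the doubling property and a weak
upper decay on `(0, R₀)`. Values of `g` at negative numbers play no role. -/
structure IsGreenFunction (W : Set (X → ℝ≥0∞)) (G : X → X → ℝ≥0∞) (g : ℝ → ℝ≥0∞)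
    (c cD : ℝ≥0) (α₀ : ℝ) (η₀ : ℝ≥0) (R₀ : ℝ≥0∞) : Prop where
  measurable : Measurable (Function.uncurry G)
  pos : ∀ x y, 0 < G x y
  diag : ∀ x, G x x = ∞
  isPotential : ∀ y, IsPotential W (fun x => G x y)
  isHarmonicOn : ∀ y, IsHarmonicOn W {y}ᶜ (fun x => G x y)
  exists_measure : ∀ p, IsPotential W p → ∃ μ : Measure X, ∀ x, p x = ∫⁻ y, G x y ∂μ
  g_antitone : AntitoneOn g (Ici 0)
  g_pos : ∀ r, 0 ≤ r → 0 < g r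
  one_le_c : 1 ≤ c
  one_lt_cD : 1 < cD
  α₀_mem : α₀ ∈ Ioo (0 : ℝ) 1
  η₀_pos : 0 < η₀
  η₀_lt_one : η₀ < 1
  R₀_pos : 0 < R₀
  lower : ∀ x y, (c : ℝ≥0∞)⁻¹ * g (dist x y) ≤ G x y
  upper : ∀ x y, G x y ≤ (c : ℝ≥0∞) * g (dist x y)
  doubling : ∀ r : ℝ, 0 < r → ENNReal.ofReal r < R₀ → g (r / 2) ≤ (cD : ℝ≥0∞) * g r
  decay : ∀ r : ℝ, 0 < r → ENNReal.ofReal r < R₀ → g r ≤ (η₀ : ℝ≥0∞) * g (α₀ * r)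

/-- The estimate of Ikeda-Watanabe type
`C_N⁻¹ ε_x^{B(x,r)ᶜ} ≤ ∫ G_{B(x,r)}(x,z) N(z,·) dl(z) ≤ C_N ε_x^{B(x,r)ᶜ}` on `B(x, M_N r)ᶜ`,
for all `x` and `0 < r < R₀`, with a measure `l` and a kernel `N`. -/
structure IkedaWatanabe (W : Set (X → ℝ≥0∞)) (G : X → X → ℝ≥0∞) (R₀ : ℝ≥0∞) (l : Measure X)
    (N : ProbabilityTheory.Kernel X X) (MN : ℝ) (CN : ℝ≥0) : Prop where
  three_le : 3 ≤ MN
  one_le : 1 ≤ CN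
  lower : ∀ (x : X) (r : ℝ), 0 < r → ENNReal.ofReal r < R₀ →
    ∀ E : Set X, MeasurableSet E → E ⊆ (Metric.ball x (MN * r))ᶜ →
      (CN : ℝ≥0∞)⁻¹ * reducedMeasure W x (Metric.ball x r)ᶜ E ≤
        ∫⁻ z in Metric.ball x r, greenOn W G (Metric.ball x r) x z * N z E ∂l
  upper : ∀ (x : X) (r : ℝ), 0 < r → ENNReal.ofReal r < R₀ →
    ∀ E : Set X, MeasurableSet E → E ⊆ (Metric.ball x (MN * r))ᶜ →
      ∫⁻ z in Metric.ball x r, greenOn W G (Metric.ball x r) x z * N z E ∂l ≤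
        (CN : ℝ≥0∞) * reducedMeasure W x (Metric.ball x r)ᶜ E

/-- The jump condition: there are `0 < R₁ ≤ ∞`, `c_J > 0` and `0 < α < 1/2` such that
`ε_x^{B(x,αr)ᶜ} ≤ c_J ε_y^{B(y,r)ᶜ}` on `B(y,r)ᶜ` whenever `0 < r < R₁` and `y ∈ B(x,αr)`. -/
def JumpCondition (W : Set (X → ℝ≥0∞)) : Prop :=
  ∃ (R₁ : ℝ≥0∞) (cJ : ℝ≥0) (α : ℝ), 0 < R₁ ∧ 0 < cJ ∧ 0 < α ∧ α < 1 / 2 ∧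
    ∀ (x : X) (r : ℝ), 0 < r → ENNReal.ofReal r < R₁ → ∀ y ∈ Metric.ball x (α * r),
      ∀ E : Set X, MeasurableSet E → E ⊆ (Metric.ball y r)ᶜ →
        reducedMeasure W x (Metric.ball x (α * r))ᶜ E ≤
          (cJ : ℝ≥0∞) * reducedMeasure W y (Metric.ball y r)ᶜ E

end Metric

end Balayage

/-! Put `ρ = αr` and `s = r / MN`. The Ikeda-Watanabe bounds turn both exit measures into integrals
of a Green function against `N(z, F)`. On the `x` side this gives at most a multiple of `λ(B(x,ρ))
g(ρ) sup N(z, F)` over `z ∈ B(x,ρ)`. On the `y` side it suffices to integrate over one ball `B(x',ρ)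
⊆ B(y,s)`, where the Green function of `B(y,s)` with pole `w` is at `y` at least a multiple of
`g(8ρ)`. If `x'` lies near the point reached from `x` by moving `4ρ` towards `F`, then every `w ∈
B(x',ρ)` is closer to each point of `F` than any `z ∈ B(x,ρ)` is, so `N(z, F) ≤ C N(w, F)`. The two
balls have equal Lebesgue measure and doubling gives `g(ρ) ≤ cD³ g(8ρ)`, hence the estimate for `F`
(`reducedMeasure_le_of_closer`). Taking `x'` from a dense sequence cuts `E` into countably many such
`F` with one common constant.

This compares with exit from `B(y,s)`; `measure_le_of_subset` replaces `s` by `r`, because on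
`B(y,r)ᶜ` the exit measure increases with the radius. That lemma is potential theory: an inequality
for differences of functions of `W`, extended to sets by a Stone-Weierstrass argument. -/

namespace Balayage

/-! ### Lattice operations, approximation and reduced functions in the cone `W` -/

section ConeLemmas

variable {X : Type*} [TopologicalSpace X] {W : Set (X → ℝ≥0∞)}

theorem continuous_fineTopology {w : X → ℝ≥0∞} (hw : w ∈ W) :
    @Continuous X ℝ≥0∞ (fineTopology W) _ w :=
  continuous_iff_le_induced.2 (inf_le_right.trans (iInf₂_le w hw))

theorem fineLscReg_eq_self {f : X → ℝ≥0∞}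
    (hf : @LowerSemicontinuous X ℝ≥0∞ (fineTopology W) _ f) : fineLscReg W f = f := by
  funext x
  refine le_antisymm (iSup₂_le fun φ hφ => hφ.1 x) ?_
  exact le_iSup₂ (f := fun (φ : X → ℝ≥0∞)
    (_ : φ ∈ {φ : X → ℝ≥0∞ | φ ≤ f ∧ @LowerSemicontinuous X ℝ≥0∞ (fineTopology W) _ φ}) => φ x)
    f ⟨le_rfl, hf⟩

/-- The minimum is already finely continuous, so the fine regularization in the balayage axiom
leaves it unchanged. -/
theorem IsBalayageSpace.min_mem (hW : IsBalayageSpace W) {u v : X → ℝ≥0∞} (hu : u ∈ W)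
    (hv : v ∈ W) : (fun x => min (u x) (v x)) ∈ W := by
  have h := hW.fineLscReg_iInf_mem {u, v} (by rintro w (rfl | rfl) <;> assumption)
  have e : (fun x => ⨅ w ∈ ({u, v} : Set (X → ℝ≥0∞)), w x) = fun x => min (u x) (v x) := by
    funext x
    rw [iInf_pair]
  rw [e, fineLscReg_eq_self] at h
  · exact h
  · have key : ∀ t : TopologicalSpace X, @Continuous X ℝ≥0∞ t _ u → @Continuous X ℝ≥0∞ t _ v →
        @LowerSemicontinuous X ℝ≥0∞ t _ fun x => min (u x) (v x) :=
      fun t hu hv => (hu.min hv).lowerSemicontinuous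
    exact key _ (continuous_fineTopology hu) (continuous_fineTopology hv)

theorem IsBalayageSpace.const_mem (hW : IsBalayageSpace W) (a : ℝ≥0) :
    (fun _ => (a : ℝ≥0∞)) ∈ W := by
  simpa using hW.smul_mem a _ hW.one_mem

theorem IsBalayageSpace.const_mem_contPart (hW : IsBalayageSpace W) (a : ℝ≥0) :
    (fun _ => (a : ℝ≥0∞)) ∈ contPart W :=
  ⟨hW.const_mem a, continuous_const, fun _ => ENNReal.coe_ne_top⟩

theorem IsBalayageSpace.add_mem_contPart (hW : IsBalayageSpace W) {u v : X → ℝ≥0∞}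
    (hu : u ∈ contPart W) (hv : v ∈ contPart W) : u + v ∈ contPart W :=
  ⟨hW.add_mem u hu.1 v hv.1, hu.2.1.add hv.2.1,
    fun x => ENNReal.add_ne_top.2 ⟨hu.2.2 x, hv.2.2 x⟩⟩

theorem IsBalayageSpace.smul_mem_contPart (hW : IsBalayageSpace W) (a : ℝ≥0) {u : X → ℝ≥0∞}
    (hu : u ∈ contPart W) : (fun x => (a : ℝ≥0∞) * u x) ∈ contPart W :=
  ⟨hW.smul_mem a u hu.1, (ENNReal.continuous_const_mul ENNReal.coe_ne_top).comp hu.2.1,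
    fun x => ENNReal.mul_ne_top ENNReal.coe_ne_top (hu.2.2 x)⟩

theorem IsBalayageSpace.min_mem_contPart (hW : IsBalayageSpace W) {u v : X → ℝ≥0∞}
    (hu : u ∈ contPart W) (hv : v ∈ contPart W) : (fun x => min (u x) (v x)) ∈ contPart W :=
  ⟨hW.min_mem hu.1 hv.1, hu.2.1.min hv.2.1,
    fun x => ne_top_of_le_ne_top (hu.2.2 x) (min_le_left _ _)⟩

theorem IsBalayageSpace.exists_contPart_ne (hW : IsBalayageSpace W) {x y : X} (hxy : x ≠ y) :
    ∃ v ∈ contPart W, v x ≠ v y := by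
  obtain ⟨w, hw, hne⟩ := hW.separates x y hxy
  by_contra! h
  refine hne ?_
  rw [hW.eq_iSup_cont w hw x, hW.eq_iSup_cont w hw y]
  exact iSup_congr fun v => iSup_congr fun hv => h v hv.1

/-- The functions `u - v` with `u`, `v` continuous real members of `W`. -/
def contDiffs (W : Set (X → ℝ≥0∞)) : Set (X → ℝ) :=
  {f | ∃ u ∈ contPart W, ∃ v ∈ contPart W, ∀ x, f x = (u x).toReal - (v x).toReal}

theorem continuous_of_mem_contDiffs {f : X → ℝ} (hf : f ∈ contDiffs W) : Continuous f := by
  obtain ⟨u, hu, v, hv, h⟩ := hf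
  rw [funext h]
  exact (continuous_iff_continuousAt.2 fun x =>
      (ENNReal.tendsto_toReal (hu.2.2 x)).comp hu.2.1.continuousAt).sub
    (continuous_iff_continuousAt.2 fun x =>
      (ENNReal.tendsto_toReal (hv.2.2 x)).comp hv.2.1.continuousAt)

theorem IsBalayageSpace.const_mem_contDiffs (hW : IsBalayageSpace W) (a : ℝ) :
    (fun _ => a) ∈ contDiffs W := by
  refine ⟨_, hW.const_mem_contPart a.toNNReal, _, hW.const_mem_contPart (-a).toNNReal, fun x => ?_⟩
  simp only [ENNReal.coe_toReal, Real.coe_toNNReal']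
  exact (max_zero_sub_max_neg_zero_eq_self a).symm

theorem IsBalayageSpace.add_mem_contDiffs (hW : IsBalayageSpace W) {f g : X → ℝ}
    (hf : f ∈ contDiffs W) (hg : g ∈ contDiffs W) : (fun x => f x + g x) ∈ contDiffs W := by
  obtain ⟨u, hu, v, hv, hf⟩ := hf
  obtain ⟨u', hu', v', hv', hg⟩ := hg
  refine ⟨_, hW.add_mem_contPart hu hu', _, hW.add_mem_contPart hv hv', fun x => ?_⟩
  simp only [Pi.add_apply, hf, hg]
  rw [ENNReal.toReal_add (hu.2.2 x) (hu'.2.2 x), ENNReal.toReal_add (hv.2.2 x) (hv'.2.2 x)]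
  ring

theorem neg_mem_contDiffs {f : X → ℝ} (hf : f ∈ contDiffs W) :
    (fun x => -f x) ∈ contDiffs W := by
  obtain ⟨u, hu, v, hv, hf⟩ := hf
  exact ⟨v, hv, u, hu, fun x => by simp [hf]⟩

theorem IsBalayageSpace.smul_mem_contDiffs (hW : IsBalayageSpace W) (a : ℝ) {f : X → ℝ}
    (hf : f ∈ contDiffs W) : (fun x => a * f x) ∈ contDiffs W := by
  have key : ∀ b : ℝ≥0, ∀ f ∈ contDiffs W, (fun x => (b : ℝ) * f x) ∈ contDiffs W := by
    rintro b f ⟨u, hu, v, hv, hf⟩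
    refine ⟨_, hW.smul_mem_contPart b hu, _, hW.smul_mem_contPart b hv, fun x => ?_⟩
    simp only [hf, ENNReal.toReal_mul, ENNReal.coe_toReal]
    ring
  rcases le_total 0 a with h | h
  · simpa only [Real.coe_toNNReal a h] using key a.toNNReal f hf
  · simpa only [Real.coe_toNNReal (-a) (neg_nonneg.2 h), neg_mul_neg] using
      key (-a).toNNReal _ (neg_mem_contDiffs hf)

/-- Over a common subtrahend, `min (u - v) (u' - v') = min (u + v') (u' + v) - (v + v')`. -/
theorem IsBalayageSpace.min_mem_contDiffs (hW : IsBalayageSpace W) {f g : X → ℝ}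
    (hf : f ∈ contDiffs W) (hg : g ∈ contDiffs W) :
    (fun x => min (f x) (g x)) ∈ contDiffs W := by
  obtain ⟨u, hu, v, hv, hf⟩ := hf
  obtain ⟨u', hu', v', hv', hg⟩ := hg
  refine ⟨_, hW.min_mem_contPart (hW.add_mem_contPart hu hv') (hW.add_mem_contPart hu' hv), _,
    hW.add_mem_contPart hv hv', fun x => ?_⟩
  simp only [Pi.add_apply, hf, hg]
  rw [ENNReal.toReal_min (ENNReal.add_ne_top.2 ⟨hu.2.2 x, hv'.2.2 x⟩)
      (ENNReal.add_ne_top.2 ⟨hu'.2.2 x, hv.2.2 x⟩),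
    ENNReal.toReal_add (hu.2.2 x) (hv'.2.2 x), ENNReal.toReal_add (hv.2.2 x) (hv'.2.2 x),
    ENNReal.toReal_add (hu'.2.2 x) (hv.2.2 x), ← min_sub_sub_right]
  congr 1 <;> ring

theorem IsBalayageSpace.max_mem_contDiffs (hW : IsBalayageSpace W) {f g : X → ℝ}
    (hf : f ∈ contDiffs W) (hg : g ∈ contDiffs W) :
    (fun x => max (f x) (g x)) ∈ contDiffs W := by
  have h := neg_mem_contDiffs
    (hW.min_mem_contDiffs (neg_mem_contDiffs hf) (neg_mem_contDiffs hg))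
  simpa only [min_neg_neg, neg_neg] using h

/-- Two-point interpolation, the hypothesis of the lattice form of Stone-Weierstrass: an affine
function of a separating `v` does it. -/
theorem IsBalayageSpace.exists_contDiffs_eq (hW : IsBalayageSpace W) {x y : X} {s t : ℝ}
    (hst : x = y → s = t) : ∃ f ∈ contDiffs W, f x = s ∧ f y = t := by
  by_cases hxy : x = y
  · exact ⟨_, hW.const_mem_contDiffs s, rfl, hst hxy⟩
  obtain ⟨v, hv, hne⟩ := hW.exists_contPart_ne hxy
  have hne' : (v x).toReal - (v y).toReal ≠ 0 := by
    rw [sub_ne_zero]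
    exact fun h => hne ((ENNReal.toReal_eq_toReal_iff' (hv.2.2 x) (hv.2.2 y)).1 h)
  have hv' : (fun z => (v z).toReal) ∈ contDiffs W :=
    ⟨v, hv, _, hW.const_mem_contPart 0, fun z => by simp⟩
  refine ⟨_, hW.add_mem_contDiffs (hW.smul_mem_contDiffs ((s - t) / ((v x).toReal - (v y).toReal))
    (hW.add_mem_contDiffs hv' (hW.const_mem_contDiffs (-(v y).toReal))))
    (hW.const_mem_contDiffs t), ?_, ?_⟩
  · field_simp
    ring
  · ring

/-- Differences of continuous real members of `W` approximate continuous functions uniformly on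
compact sets. -/
theorem IsBalayageSpace.exists_contDiffs_near (hW : IsBalayageSpace W) {K : Set X}
    (hK : IsCompact K) (φ : C(X, ℝ)) {ε : ℝ} (hε : 0 < ε) :
    ∃ f ∈ contDiffs W, ∀ x ∈ K, |f x - φ x| < ε := by
  have : CompactSpace K := isCompact_iff_compactSpace.1 hK
  let S : Set C(K, ℝ) := {ψ | ∃ f ∈ contDiffs W, ∀ x : K, ψ x = f x}
  have hS : closure S = ⊤ := by
    refine ContinuousMap.sublattice_closure_eq_top S ?_ ?_ ?_ ?_
    · exact ⟨0, _, hW.const_mem_contDiffs 0, fun x => rfl⟩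
    · rintro ψ ⟨f, hf, h⟩ ψ' ⟨f', hf', h'⟩
      exact ⟨_, hW.min_mem_contDiffs hf hf', fun x => by simp [h, h']⟩
    · rintro ψ ⟨f, hf, h⟩ ψ' ⟨f', hf', h'⟩
      exact ⟨_, hW.max_mem_contDiffs hf hf', fun x => by simp [h, h']⟩
    · intro v x y
      obtain ⟨f, hf, hx, hy⟩ := hW.exists_contDiffs_eq (x := (x : X)) (y := y) (s := v x)
        (t := v y) (fun h => by rw [Subtype.ext h])
      exact ⟨⟨fun z => f z, (continuous_of_mem_contDiffs hf).comp continuous_subtype_val⟩,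
        ⟨f, hf, fun z => rfl⟩, hx, hy⟩
  have hmem : φ.restrict K ∈ closure S := hS ▸ trivial
  obtain ⟨ψ, ⟨f, hf, h⟩, hd⟩ := Metric.mem_closure_iff.1 hmem ε hε
  refine ⟨f, hf, fun x hx => ?_⟩
  have := (ContinuousMap.dist_lt_iff hε).1 hd ⟨x, hx⟩
  rw [dist_comm, Real.dist_eq, h] at this
  exact this

omit [TopologicalSpace X] in
theorem reduced_le {u v : X → ℝ≥0∞} {A : Set X} (hv : v ∈ W) (h : ∀ a ∈ A, u a ≤ v a) (x : X) :
    reduced W u A x ≤ v x :=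
  iInf₂_le (f := fun (v : X → ℝ≥0∞) (_ : v ∈ {v ∈ W | ∀ a ∈ A, u a ≤ v a}) => v x) v ⟨hv, h⟩

omit [TopologicalSpace X] in
theorem reduced_mono {u v : X → ℝ≥0∞} {A A' : Set X} (hA : A ⊆ A') (h : ∀ a ∈ A, u a ≤ v a)
    (x : X) : reduced W u A x ≤ reduced W v A' x :=
  le_iInf₂ fun _ hw => reduced_le hw.1 (fun a ha => (h a ha).trans (hw.2 a (hA ha))) x

/-- A competitor for the reduced function may be cut off by `u`, which makes it equal to `u` on `A`.
-/
theorem IsBalayageSpace.exists_lt_of_reduced_lt (hW : IsBalayageSpace W) {u : X → ℝ≥0∞}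
    (hu : u ∈ W) {A : Set X} {y : X} {b : ℝ≥0∞} (h : reduced W u A y < b) :
    ∃ v ∈ W, v ≤ u ∧ (∀ a ∈ A, v a = u a) ∧ v y < b := by
  obtain ⟨v, hv⟩ := iInf_lt_iff.1 h
  obtain ⟨⟨hvW, hvA⟩, hvy⟩ := iInf_lt_iff.1 hv
  exact ⟨_, hW.min_mem hvW hu, fun x => min_le_right _ _, fun a ha => min_eq_right (hvA a ha),
    (min_le_left _ _).trans_lt hvy⟩

end ConeLemmas

/-! ### Integral inequalities for representing measures -/

section Measures

variable {X : Type*} [TopologicalSpace X] [MeasurableSpace X] {W : Set (X → ℝ≥0∞)}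

/-- If `μ` and `ν` represent `u ↦ R_u^{A'}(y)` and `u ↦ R_u^A(y)` where `A ⊆ A'`, then
`∫_A (u₁ - u₂) dμ ≤ ∫ (u₁ - u₂) dν` for `u₂ ≤ u₁`. -/
theorem IsBalayageSpace.setLIntegral_add_le [OpensMeasurableSpace X] (hW : IsBalayageSpace W)
    {y : X} {A A' : Set X} (hAA' : A ⊆ A') (hA : MeasurableSet A) {μ ν : Measure X}
    (hμ : ∀ u ∈ W, ∫⁻ z, u z ∂μ = reduced W u A' y)
    (hν : ∀ u ∈ W, ∫⁻ z, u z ∂ν = reduced W u A y)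
    {u₁ u₂ : X → ℝ≥0∞} (hu₁ : u₁ ∈ W) (hu₂ : u₂ ∈ W) (hle : u₂ ≤ u₁) :
    ∫⁻ z in A, u₁ z ∂μ + ∫⁻ z, u₂ z ∂ν ≤ ∫⁻ z, u₁ z ∂ν + ∫⁻ z in A, u₂ z ∂μ := by
  refine ENNReal.le_of_forall_pos_le_add fun ε hε hfin => ?_
  have hfin' : ∫⁻ z, u₁ z ∂ν ≠ ∞ := (ENNReal.add_lt_top.1 hfin).1.ne
  -- A near-minimizer `v₁` for `R_{u₁}^A(y)`, paired with `v₂ = min v₁ u₂`. On `A` they agree with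
  -- `u₁` and `u₂`, and `v₁ - v₂ ≥ 0` everywhere, so discarding `Aᶜ` only lowers `∫ (v₁ - v₂) dμ`.
  obtain ⟨v₁, hv₁, -, hv₁A, hv₁y⟩ := hW.exists_lt_of_reduced_lt hu₁ (A := A) (y := y)
    (b := ∫⁻ z, u₁ z ∂ν + ε) (by
      rw [← hν u₁ hu₁]
      exact ENNReal.lt_add_right hfin' (by simpa using hε.ne'))
  have hv₂ : (fun x => min (v₁ x) (u₂ x)) ∈ W := hW.min_mem hv₁ hu₂
  have hv₂A : ∀ a ∈ A, min (v₁ a) (u₂ a) = u₂ a := fun a ha =>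
    min_eq_right ((hle a).trans (hv₁A a ha).ge)
  calc ∫⁻ z in A, u₁ z ∂μ + ∫⁻ z, u₂ z ∂ν
      ≤ ∫⁻ z in A, v₁ z ∂μ + ∫⁻ z, min (v₁ z) (u₂ z) ∂μ := by
        refine add_le_add (setLIntegral_mono' hA fun z hz => (hv₁A z hz).ge) ?_
        rw [hν u₂ hu₂, hμ _ hv₂]
        exact reduced_mono hAA' (fun a ha => (hv₂A a ha).ge) y
    _ = ∫⁻ z in A, v₁ z ∂μ +
          (∫⁻ z in A, min (v₁ z) (u₂ z) ∂μ + ∫⁻ z in Aᶜ, min (v₁ z) (u₂ z) ∂μ) := by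
        rw [lintegral_add_compl _ hA]
    _ ≤ ∫⁻ z in A, v₁ z ∂μ + (∫⁻ z in A, u₂ z ∂μ + ∫⁻ z in Aᶜ, v₁ z ∂μ) := by
        gcongr
        · exact min_le_right _ _
        · exact min_le_left _ _
    _ = ∫⁻ z, v₁ z ∂μ + ∫⁻ z in A, u₂ z ∂μ := by
        rw [← lintegral_add_compl (μ := μ) v₁ hA]
        ring
    _ ≤ (∫⁻ z, u₁ z ∂ν + ε) + ∫⁻ z in A, u₂ z ∂μ := by
        gcongr
        rw [hμ v₁ hv₁]
        exact (reduced_le hv₁ (fun _ _ => le_rfl) y).trans hv₁y.le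
    _ = ∫⁻ z, u₁ z ∂ν + ∫⁻ z in A, u₂ z ∂μ + ε := by ring

/-- Write `f = u - v`; the integrals of `v` are at most `v y < ∞`, so they cancel in the preceding
inequality. -/
theorem IsBalayageSpace.setLIntegral_ofReal_le [OpensMeasurableSpace X] (hW : IsBalayageSpace W)
    {y : X} {A A' : Set X} (hAA' : A ⊆ A') (hA : MeasurableSet A) {μ ν : Measure X}
    (hμ : ∀ u ∈ W, ∫⁻ z, u z ∂μ = reduced W u A' y)
    (hν : ∀ u ∈ W, ∫⁻ z, u z ∂ν = reduced W u A y)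
    {f : X → ℝ} (hf : f ∈ contDiffs W) (hf0 : ∀ x, 0 ≤ f x) :
    ∫⁻ z in A, ENNReal.ofReal (f z) ∂μ ≤ ∫⁻ z, ENNReal.ofReal (f z) ∂ν := by
  have hfm : Measurable fun z => ENNReal.ofReal (f z) :=
    (continuous_of_mem_contDiffs hf).measurable.ennreal_ofReal
  obtain ⟨u, hu, v, hv, h⟩ := hf
  have huv : ∀ z, u z = ENNReal.ofReal (f z) + v z := by
    intro z
    rw [← ENNReal.ofReal_toReal (hu.2.2 z), ← ENNReal.ofReal_toReal (hv.2.2 z), ← ENNReal.ofReal_add (hf0 z) ENNReal.toReal_nonneg, h z]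
    congr 1
    ring
  have key := hW.setLIntegral_add_le hAA' hA hμ hν hu.1 hv.1
    (fun z => by rw [huv z]; exact le_add_self)
  simp only [huv] at key
  rw [lintegral_add_left hfm, lintegral_add_left hfm, add_assoc, add_assoc,
    add_comm (∫⁻ z, v z ∂ν)] at key
  refine (ENNReal.add_le_add_iff_right (ENNReal.add_ne_top.2 ⟨?_, ?_⟩)).1 key
  · refine ne_top_of_le_ne_top ?_ (setLIntegral_le_lintegral A v)
    rw [hμ v hv.1]
    exact ne_top_of_le_ne_top (hv.2.2 y) (reduced_le hv.1 (fun _ _ => le_rfl) y)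
  · rw [hν v hv.1]
    exact ne_top_of_le_ne_top (hv.2.2 y) (reduced_le hv.1 (fun _ _ => le_rfl) y)

theorem IsBalayageSpace.measure_univ_lt_top (hW : IsBalayageSpace W) {y : X} {A : Set X}
    {μ : Measure X} (hμ : ∀ u ∈ W, ∫⁻ z, u z ∂μ = reduced W u A y) : μ univ < ∞ := by
  have h := hμ _ hW.one_mem
  rw [lintegral_one] at h
  rw [h]
  exact (reduced_le hW.one_mem (fun _ _ => le_rfl) y).trans_lt ENNReal.one_lt_top

end Measures

/-! ### Monotonicity of reduced measures in the set -/

section Domination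

variable {X : Type*} [MetricSpace X] [CompleteSpace X] [SecondCountableTopology X]
  [MeasurableSpace X] [BorelSpace X] {W : Set (X → ℝ≥0∞)}

/-- Enlarging the set `A` decreases the reduced measure on subsets of `A`. -/
theorem IsBalayageSpace.measure_le_of_subset (hW : IsBalayageSpace W)
    {y : X} {A A' : Set X} (hAA' : A ⊆ A') (hA : MeasurableSet A) {μ ν : Measure X}
    (hμ : ∀ u ∈ W, ∫⁻ z, u z ∂μ = reduced W u A' y)
    (hν : ∀ u ∈ W, ∫⁻ z, u z ∂ν = reduced W u A y)
    {E : Set X} (hE : MeasurableSet E) (hEA : E ⊆ A) : μ E ≤ ν E := by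
  have : IsFiniteMeasure μ := ⟨hW.measure_univ_lt_top hμ⟩
  have : IsFiniteMeasure ν := ⟨hW.measure_univ_lt_top hν⟩
  rw [hE.measure_eq_iSup_isCompact_of_ne_top (measure_ne_top μ E)]
  refine iSup₂_le fun K hKE => iSup_le fun hK => ?_
  rw [Set.measure_eq_iInf_isOpen E ν]
  refine le_iInf₂ fun U hEU => le_iInf fun hU => ?_
  refine ENNReal.le_of_forall_pos_le_add fun ε hε _ => ?_
  -- Approximation is uniform only on compact sets; tightness leaves mass at most `ε` outside `L`.
  obtain ⟨L, hL, hLε⟩ := isTightMeasureSet_iff_exists_isCompact_measure_compl_le.1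
    (isTightMeasureSet_singleton (μ := ν)) ε (by simpa using hε)
  have hLε : ν Lᶜ ≤ ε := hLε ν rfl
  obtain ⟨φ, hφ0, hφ1, -⟩ := exists_continuous_zero_one_of_isClosed (s := L \ U) (t := K)
    (hL.diff hU).isClosed hK.isClosed
    (disjoint_left.2 fun x hx hxK => hx.2 (hEU (hKE hxK)))
  obtain ⟨f, hf, hfφ⟩ := hW.exists_contDiffs_near (hL.union hK) φ (show (0 : ℝ) < 1 / 4 by norm_num)
  -- Since `f` is within `1/4` of `φ`, `2f - 1/2` exceeds `1` on `K` and is negative on `L \ U`;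
  -- clipping to `[0, 1]` stays within `contDiffs W`.
  let F : X → ℝ := fun x => max 0 (min 1 (2 * f x + (-1 / 2)))
  have hF : F ∈ contDiffs W := hW.max_mem_contDiffs (hW.const_mem_contDiffs 0)
    (hW.min_mem_contDiffs (hW.const_mem_contDiffs 1)
      (hW.add_mem_contDiffs (hW.smul_mem_contDiffs 2 hf) (hW.const_mem_contDiffs (-1 / 2))))
  have hFK : ∀ x ∈ K, F x = 1 := by
    intro x hx
    have h := abs_lt.1 (hfφ x (Or.inr hx))
    rw [hφ1 hx, Pi.one_apply] at h
    simp only [F]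
    rw [min_eq_left (by linarith), max_eq_right zero_le_one]
  have hFL : ∀ x ∈ L \ U, F x = 0 := by
    intro x hx
    have h := abs_lt.1 (hfφ x (Or.inl hx.1))
    rw [hφ0 hx, Pi.zero_apply] at h
    exact max_eq_left ((min_le_right _ _).trans (by linarith))
  have hF1 : ∀ x, F x ≤ 1 := fun x => max_le zero_le_one (min_le_left _ _)
  calc μ K = ∫⁻ z in K, ENNReal.ofReal (F z) ∂μ := by
        rw [setLIntegral_congr_fun hK.measurableSet (g := fun _ => 1)
          (fun x hx => by simp [hFK x hx])]
        simp
    _ ≤ ∫⁻ z in A, ENNReal.ofReal (F z) ∂μ := lintegral_mono_set (hKE.trans hEA)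
    _ ≤ ∫⁻ z, ENNReal.ofReal (F z) ∂ν :=
        hW.setLIntegral_ofReal_le hAA' hA hμ hν hF (fun x => le_max_left _ _)
    _ ≤ ∫⁻ z, (U ∪ Lᶜ).indicator 1 z ∂ν := by
        refine lintegral_mono fun z => ?_
        by_cases hz : z ∈ U ∪ Lᶜ
        · rw [indicator_of_mem hz, Pi.one_apply]
          exact ENNReal.ofReal_le_one.2 (hF1 z)
        · simp only [mem_union, mem_compl_iff, not_or, not_not] at hz
          simp [hFL z ⟨hz.2, hz.1⟩]
    _ = ν (U ∪ Lᶜ) := lintegral_indicator_one (hU.union hL.isClosed.isOpen_compl).measurableSet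
    _ ≤ ν U + ε := (measure_union_le _ _).trans (by gcongr)

end Domination

/-! ### Exit measures, Green functions and jump kernels on balls -/

section Ball

variable {X : Type*} [MetricSpace X] [MeasurableSpace X] {W : Set (X → ℝ≥0∞)}
  {G : X → X → ℝ≥0∞} {g : ℝ → ℝ≥0∞} {c cD : ℝ≥0} {α₀ : ℝ} {η₀ : ℝ≥0} {R₀ : ℝ≥0∞}

omit [MetricSpace X] in
-- The default value of `reducedMeasure` is `0`, so a nonzero value certifies that a representing
-- measure exists.
theorem lintegral_reducedMeasure_of_ne_zero {x : X} {A : Set X}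
    (h : reducedMeasure W x A ≠ 0) (u : X → ℝ≥0∞) (hu : u ∈ W) :
    ∫⁻ z, u z ∂(reducedMeasure W x A) = reduced W u A x := by
  unfold reducedMeasure at h ⊢
  split_ifs at h ⊢ with hex
  · exact hex.choose_spec u hu
  · exact absurd rfl h

/-- The mean value property of the Green function yields reduced measures for complements of
balls. -/
theorem IsGreenFunction.lintegral_reducedMeasure_ball [ProperSpace X]
    (hG : IsGreenFunction W G g c cD α₀ η₀ R₀) {x w : X} {r : ℝ} (hr : 0 < r)
    (hw : r < dist w x) {u : X → ℝ≥0∞} (hu : u ∈ W) :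
    ∫⁻ z, u z ∂(reducedMeasure W x (Metric.ball x r)ᶜ) =
      reduced W u (Metric.ball x r)ᶜ x := by
  refine lintegral_reducedMeasure_of_ne_zero (fun h0 => ?_) u hu
  have hcl : closure (Metric.ball x r) ⊆ {w}ᶜ := by
    refine Metric.closure_ball_subset_closedBall.trans ?_
    rw [subset_compl_singleton_iff, Metric.mem_closedBall]
    exact hw.not_ge
  -- With a pole `w` off the closed ball, a zero measure would force `G x w = 0`.
  have h := (hG.isHarmonicOn w).mean_value (Metric.ball x r) Metric.isOpen_ball
    Metric.isBounded_ball.isCompact_closure hcl x (Metric.mem_ball_self hr)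
  rw [h0, lintegral_zero_measure] at h
  exact (hG.pos x w).ne h

theorem IsGreenFunction.reducedMeasure_ball_le [ProperSpace X] [BorelSpace X]
    (hW : IsBalayageSpace W) (hG : IsGreenFunction W G g c cD α₀ η₀ R₀) {y w : X} {s r : ℝ}
    (hs : 0 < s) (hsr : s ≤ r) (hw : r < dist w y) {E : Set X} (hE : MeasurableSet E)
    (hEr : E ⊆ (Metric.ball y r)ᶜ) :
    reducedMeasure W y (Metric.ball y s)ᶜ E ≤ reducedMeasure W y (Metric.ball y r)ᶜ E :=
  hW.measure_le_of_subset (compl_subset_compl.2 (Metric.ball_subset_ball hsr))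
    Metric.isOpen_ball.measurableSet.compl
    (fun _ hu => hG.lintegral_reducedMeasure_ball hs (hsr.trans_lt hw) hu)
    (fun _ hu => hG.lintegral_reducedMeasure_ball (hs.trans_le hsr) hw hu) hE hEr

theorem IsGreenFunction.ne_top_of_dist_eq (hG : IsGreenFunction W G g c cD α₀ η₀ R₀) {x w : X}
    {t : ℝ} (ht : 0 < t) (hw : dist x w = t) : g t ≠ ∞ := by
  intro h
  have hne : G x w ≠ ∞ := (hG.isHarmonicOn w).ne_top x (dist_pos.1 (hw ▸ ht))
  have hl := hG.lower x w
  rw [hw, h, ENNReal.mul_top (by simp)] at hl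
  exact hne (top_le_iff.1 hl)

theorem IsGreenFunction.iterate_decay (hG : IsGreenFunction W G g c cD α₀ η₀ R₀) {t : ℝ}
    (ht : 0 < t) (htR : ENNReal.ofReal t < R₀) (k : ℕ) :
    g t ≤ (η₀ : ℝ≥0∞) ^ k * g (α₀ ^ k * t) := by
  induction k with
  | zero => simp
  | succ k ih =>
    refine ih.trans ?_
    have hpos : 0 < α₀ ^ k * t := mul_pos (pow_pos hG.α₀_mem.1 k) ht
    have hle : α₀ ^ k * t ≤ t :=
      mul_le_of_le_one_left ht.le (pow_le_one₀ hG.α₀_mem.1.le hG.α₀_mem.2.le)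
    calc (η₀ : ℝ≥0∞) ^ k * g (α₀ ^ k * t)
        ≤ (η₀ : ℝ≥0∞) ^ k * (η₀ * g (α₀ * (α₀ ^ k * t))) := by
          gcongr
          exact hG.decay _ hpos ((ENNReal.ofReal_le_ofReal hle).trans_lt htR)
      _ = (η₀ : ℝ≥0∞) ^ (k + 1) * g (α₀ ^ (k + 1) * t) := by
          rw [← mul_assoc, ← pow_succ, ← mul_assoc, ← pow_succ']

theorem IsGreenFunction.iterate_doubling (hG : IsGreenFunction W G g c cD α₀ η₀ R₀) {t : ℝ}
    (ht : 0 < t) (k : ℕ) (htR : ENNReal.ofReal (2 ^ k * t) < R₀) :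
    g t ≤ (cD : ℝ≥0∞) ^ k * g (2 ^ k * t) := by
  induction k with
  | zero => simp
  | succ k ih =>
    have hpos : (0 : ℝ) < 2 ^ k * t := by positivity
    refine (ih ((ENNReal.ofReal_le_ofReal ?_).trans_lt htR)).trans ?_
    · rw [pow_succ]
      linarith
    · rw [pow_succ, mul_assoc]
      gcongr
      have h := hG.doubling (2 ^ (k + 1) * t) (by positivity) htR
      rwa [show (2 : ℝ) ^ (k + 1) * t / 2 = 2 ^ k * t by rw [pow_succ]; ring] at h

theorem IsBalayageSpace.reduced_le_of_le {X : Type*} [TopologicalSpace X]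
    {W : Set (X → ℝ≥0∞)} (hW : IsBalayageSpace W) {u : X → ℝ≥0∞} {A : Set X}
    {b : ℝ≥0∞} (hu : ∀ a ∈ A, u a ≤ b) (x : X) : reduced W u A x ≤ b := by
  rcases eq_or_ne b ∞ with rfl | hb
  · exact le_top
  · lift b to ℝ≥0 using hb
    exact reduced_le (hW.const_mem b) hu x

/-- Lower estimate of the Green function of a ball near its centre. -/
theorem IsGreenFunction.le_greenOn_ball (hW : IsBalayageSpace W)
    (hG : IsGreenFunction W G g c cD α₀ η₀ R₀) {s t : ℝ} (ht : 0 < t) (hts : t ≤ s / 2)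
    (hfin : g t ≠ ∞) (hgs : 2 * (c : ℝ≥0∞) ^ 2 * g (s / 2) ≤ g t) {y w : X}
    (hw : dist y w ≤ t) :
    (2 * (c : ℝ≥0∞))⁻¹ * g t ≤ greenOn W G (Metric.ball y s) y w := by
  have hc0 : (c : ℝ≥0∞) ≠ 0 := by
    have := hG.one_le_c
    exact ENNReal.coe_ne_zero.2 (by positivity)
  have hct : (c : ℝ≥0∞) ≠ ∞ := ENNReal.coe_ne_top
  -- `T` is half of the lower bound `c⁻¹ g(t)` for `G y w`; the constant `T` lies in `W` and
  -- dominates `G(·, w)` off the ball, so the reduced function costs at most the other half.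
  set T := (2 * (c : ℝ≥0∞))⁻¹ * g t with hT
  have hTfin : T ≠ ∞ := ENNReal.mul_ne_top (ENNReal.inv_ne_top.2 (mul_ne_zero two_ne_zero hc0)) hfin
  have h2T : T + T = (c : ℝ≥0∞)⁻¹ * g t := by
    rw [hT, ENNReal.mul_inv (Or.inl two_ne_zero) (Or.inl ENNReal.ofNat_ne_top), ← two_mul,
      ← mul_assoc, ← mul_assoc, ENNReal.mul_inv_cancel two_ne_zero ENNReal.ofNat_ne_top, one_mul]
  have hGT : T + T ≤ G y w := by
    rw [h2T]
    refine le_trans ?_ (hG.lower y w)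
    gcongr
    exact hG.g_antitone dist_nonneg ht.le hw
  have hRT : reduced W (fun z => G z w) (Metric.ball y s)ᶜ y ≤ T := by
    refine hW.reduced_le_of_le (fun z hz => (hG.upper z w).trans ?_) y
    rw [mem_compl_iff, Metric.mem_ball, not_lt] at hz
    have hzw : s / 2 ≤ dist z w := by
      have := dist_triangle z w y
      rw [dist_comm w y] at this
      linarith
    calc (c : ℝ≥0∞) * g (dist z w) ≤ c * g (s / 2) := by
          gcongr
          exact hG.g_antitone (ht.le.trans hts) dist_nonneg hzw
      _ = (2 * (c : ℝ≥0∞))⁻¹ * (2 * (c : ℝ≥0∞) ^ 2 * g (s / 2)) := by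
          rw [pow_two, ← mul_assoc 2, mul_assoc (2 * (c : ℝ≥0∞)), ← mul_assoc,
            ENNReal.inv_mul_cancel (mul_ne_zero two_ne_zero hc0)
              (ENNReal.mul_ne_top ENNReal.ofNat_ne_top hct), one_mul]
      _ ≤ T := by
          rw [hT]
          gcongr
  calc T = T + T - T := (ENNReal.add_sub_cancel_right hTfin).symm
    _ ≤ G y w - reduced W (fun z => G z w) (Metric.ball y s)ᶜ y := tsub_le_tsub hGT hRT

theorem withDensity_le_mul_of_closer {N : ProbabilityTheory.Kernel X X} {C : ℝ≥0}
    {lt : Measure X} {n : X → X → ℝ≥0}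
    (hn : ∀ y, Measurable (n y))
    (hNn : ∀ y, N y = lt.withDensity (fun z => (n y z : ℝ≥0∞))) {a : ℝ}
    (hdec : ∀ (x : X) (r : ℝ), 0 < r → ENNReal.ofReal r < R₀ →
      ∀ y ∈ Metric.ball x r, ∀ z ∈ (Metric.ball x (a * r))ᶜ,
        dist y z ≤ dist x z → n x z ≤ C * n y z)
    {x y : X} {r : ℝ} (hr : 0 < r) (hrR : ENNReal.ofReal r < R₀) (hy : y ∈ Metric.ball x r)
    {F : Set X} (hF : MeasurableSet F) (hFx : F ⊆ (Metric.ball x (a * r))ᶜ)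
    (hcl : ∀ z ∈ F, dist y z ≤ dist x z) : N x F ≤ C * N y F := by
  rw [hNn, hNn, withDensity_apply _ hF, withDensity_apply _ hF,
    ← lintegral_const_mul _ (hn y).coe_nnreal_ennreal]
  refine setLIntegral_mono' hF fun z hz => ?_
  exact_mod_cast hdec x r hr hrR y hy z (hFx hz) (hcl z hz)

/-- Upper estimate of the Ikeda-Watanabe integral over a ball. -/
theorem setLIntegral_greenOn_mul_le [OpensMeasurableSpace X] [ProperSpace X]
    {l : Measure X} [IsFiniteMeasureOnCompacts l] [l.IsOpenPosMeasure]
    {N : ProbabilityTheory.Kernel X X} {CG : ℝ≥0} (hG : IsGreenFunction W G g c cD α₀ η₀ R₀) {x : X} {ρ : ℝ} (hρ : 0 < ρ)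
    (hGg : (l (Metric.ball x ρ))⁻¹ * ∫⁻ z in Metric.ball x ρ, G x z ∂l ≤ (CG : ℝ≥0∞) * g ρ)
    {F : Set X} {J : ℝ≥0∞} (hJ : ∀ z ∈ Metric.ball x ρ, N z F ≤ J) :
    ∫⁻ z in Metric.ball x ρ, greenOn W G (Metric.ball x ρ) x z * N z F ∂l ≤
      l (Metric.ball x ρ) * (CG * g ρ) * J := by
  have hGm : Measurable fun z => G x z := hG.measurable.of_uncurry_left
  calc ∫⁻ z in Metric.ball x ρ, greenOn W G (Metric.ball x ρ) x z * N z F ∂l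
      ≤ ∫⁻ z in Metric.ball x ρ, G x z * J ∂l :=
        setLIntegral_mono' measurableSet_ball fun z hz => mul_le_mul' tsub_le_self (hJ z hz)
    _ = (∫⁻ z in Metric.ball x ρ, G x z ∂l) * J := lintegral_mul_const _ hGm
    _ ≤ l (Metric.ball x ρ) * (CG * g ρ) * J := by
        gcongr
        exact (ENNReal.inv_mul_le_iff (Metric.measure_ball_pos l x hρ).ne'
          measure_ball_lt_top.ne).1 hGg

/-- Iterate the decay until `η₀ ^ k < 1 / (2c²)` and take `β = α₀ ^ k`. This supplies the gap needed
by `le_greenOn_ball`. -/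
theorem IsGreenFunction.exists_decay_const (hG : IsGreenFunction W G g c cD α₀ η₀ R₀) :
    ∃ β : ℝ, 0 < β ∧ β ≤ 1 ∧ ∀ t, 0 < t → ENNReal.ofReal t < R₀ →
      2 * (c : ℝ≥0∞) ^ 2 * g t ≤ g (β * t) := by
  have hc := hG.one_le_c
  obtain ⟨k, hk⟩ := exists_pow_lt_of_lt_one (show 0 < (2 * c ^ 2)⁻¹ by positivity) hG.η₀_lt_one
  refine ⟨α₀ ^ k, pow_pos hG.α₀_mem.1 k, pow_le_one₀ hG.α₀_mem.1.le hG.α₀_mem.2.le,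
    fun t ht htR => ?_⟩
  have h1 : 2 * (c : ℝ≥0∞) ^ 2 * (η₀ : ℝ≥0∞) ^ k ≤ 1 := by
    have : 2 * c ^ 2 * η₀ ^ k ≤ 1 := by
      calc 2 * c ^ 2 * η₀ ^ k ≤ 2 * c ^ 2 * (2 * c ^ 2)⁻¹ := by gcongr
        _ = 1 := mul_inv_cancel₀ (by positivity)
    exact_mod_cast this
  calc 2 * (c : ℝ≥0∞) ^ 2 * g t
      ≤ 2 * (c : ℝ≥0∞) ^ 2 * ((η₀ : ℝ≥0∞) ^ k * g (α₀ ^ k * t)) := by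
        gcongr
        exact hG.iterate_decay ht htR k
    _ = 2 * (c : ℝ≥0∞) ^ 2 * (η₀ : ℝ≥0∞) ^ k * g (α₀ ^ k * t) := by ring
    _ ≤ g (α₀ ^ k * t) := mul_le_of_le_one_left' h1

end Ball

/-! ### Countable covers and the shifted centres -/

theorem exists_measurable_partition {X : Type*} [MeasurableSpace X] {E : Set X}
    (hE : MeasurableSet E) {S : ℕ → Set X} (hS : ∀ i, MeasurableSet (S i)) (h : E ⊆ ⋃ i, S i) :
    ∃ F : ℕ → Set X, (∀ i, MeasurableSet (F i)) ∧ (∀ i, F i ⊆ S i) ∧ E = ⋃ i, F i ∧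
      Pairwise (Function.onFun Disjoint F) := by
  refine ⟨disjointed fun i => S i ∩ E, ?_, ?_, ?_, disjoint_disjointed _⟩
  · exact fun i => MeasurableSet.disjointed (fun i => (hS i).inter hE) i
  · exact fun i => (disjointed_le _ i).trans inter_subset_left
  · rw [iUnion_disjointed, ← iUnion_inter, inter_eq_right.2 h]

/-- A measure inequality may be checked on the pieces of a countable measurable cover. -/
theorem measure_le_mul_of_cover {X : Type*} [MeasurableSpace X] {μ ν : Measure X} {b : ℝ≥0∞}
    {E : Set X} (hE : MeasurableSet E) {S : ℕ → Set X} (hS : ∀ i, MeasurableSet (S i))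
    (h : E ⊆ ⋃ i, S i)
    (hle : ∀ i, ∀ F, MeasurableSet F → F ⊆ E → F ⊆ S i → μ F ≤ b * ν F) : μ E ≤ b * ν E := by
  obtain ⟨F, hF, hFS, rfl, hd⟩ := exists_measurable_partition hE hS h
  rw [measure_iUnion hd hF, measure_iUnion hd hF, ← ENNReal.tsum_mul_left]
  exact ENNReal.tsum_le_tsum fun i => hle i _ (hF i) (subset_iUnion F i) (hFS i)

/-- Moving from `x` towards `z` by `4ρ` reaches, up to a small error, a member of a given dense
sequence. -/
theorem exists_denseSeq_closer {V : Type*} [NormedAddCommGroup V] [NormedSpace ℝ V]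
    [SecondCountableTopology V] {x z : V} {ρ : ℝ} (hρ : 0 < ρ) (hz : 4 * ρ ≤ dist x z) :
    ∃ i, dist x (TopologicalSpace.denseSeq V i) < 5 * ρ ∧ dist (TopologicalSpace.denseSeq V i) z + 2 * ρ < dist x z := by
  have hd : 0 < dist x z := by linarith
  set p : V := AffineMap.lineMap x z (4 * ρ / dist x z)
  have h1 : dist x p = 4 * ρ := by
    rw [dist_left_lineMap, Real.norm_of_nonneg (by positivity), div_mul_cancel₀ _ hd.ne']
  have h2 : dist p z = dist x z - 4 * ρ := by
    rw [dist_lineMap_right, Real.norm_of_nonneg (sub_nonneg.2 ((div_le_one hd).2 hz)), sub_mul,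
      div_mul_cancel₀ _ hd.ne', one_mul]
  obtain ⟨i, hi⟩ := (TopologicalSpace.denseRange_denseSeq V).exists_dist_lt p hρ
  refine ⟨i, ?_, ?_⟩
  · linarith [dist_triangle x p (TopologicalSpace.denseSeq V i)]
  · have := dist_triangle (TopologicalSpace.denseSeq V i) p z
    rw [dist_comm _ p] at this
    linarith

/-! ### The jump estimate -/

section Jump

variable {V : Type*} [NormedAddCommGroup V] [NormedSpace ℝ V] [FiniteDimensional ℝ V]
  [MeasurableSpace V] [BorelSpace V] {W : Set (V → ℝ≥0∞)}
  {G : V → V → ℝ≥0∞} {g : ℝ → ℝ≥0∞} {c cD : ℝ≥0} {α₀ : ℝ} {η₀ : ℝ≥0} {R₀ : ℝ≥0∞}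
  {l : Measure V} [l.IsAddHaarMeasure]
  {N : ProbabilityTheory.Kernel V V} {MN : ℝ} {CN CG C : ℝ≥0}

/-- The jump estimate on sets which are seen from `x` in the direction of `x'`. -/
theorem IkedaWatanabe.reducedMeasure_le_of_closer (hN : IkedaWatanabe W G R₀ l N MN CN)
    (hW : IsBalayageSpace W) (hG : IsGreenFunction W G g c cD α₀ η₀ R₀) {x x' y : V} {ρ s : ℝ}
    (hρ : 0 < ρ) (h8 : 8 * ρ ≤ s / 2) (hsR : ENNReal.ofReal s < R₀)
    (hfin : g (8 * ρ) ≠ ∞) (hgs : 2 * (c : ℝ≥0∞) ^ 2 * g (s / 2) ≤ g (8 * ρ))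
    (hGg : (l (Metric.ball x ρ))⁻¹ * ∫⁻ z in Metric.ball x ρ, G x z ∂l ≤ (CG : ℝ≥0∞) * g ρ)
    (hyx : dist y x < ρ) (hx' : dist x x' < 5 * ρ) {F : Set V} (hF : MeasurableSet F)
    (hFx : F ⊆ (Metric.ball x (MN * ρ))ᶜ) (hFy : F ⊆ (Metric.ball y (MN * s))ᶜ)
    (hNF : ∀ z ∈ Metric.ball x ρ, ∀ w ∈ Metric.ball x' ρ, N z F ≤ C * N w F) :
    reducedMeasure W x (Metric.ball x ρ)ᶜ F ≤
      ((CN * CG * cD ^ 3 * (2 * c * C) * CN : ℝ≥0) : ℝ≥0∞) *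
        reducedMeasure W y (Metric.ball y s)ᶜ F := by
  have : ProperSpace V := FiniteDimensional.proper ℝ V
  have hs : 0 < s := by linarith
  have hle : ∀ t ≤ s, ENNReal.ofReal t < R₀ := fun t ht =>
    (ENNReal.ofReal_le_ofReal ht).trans_lt hsR
  have hCN0 : (CN : ℝ≥0∞) ≠ 0 := by
    have := hN.one_le
    exact ENNReal.coe_ne_zero.2 (by positivity)
  have hc0 : (c : ℝ≥0∞) ≠ 0 := by
    have := hG.one_le_c
    exact ENNReal.coe_ne_zero.2 (by positivity)
  have h2c0 : 2 * (c : ℝ≥0∞) ≠ 0 := mul_ne_zero two_ne_zero hc0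
  have h2ct : 2 * (c : ℝ≥0∞) ≠ ∞ := ENNReal.mul_ne_top ENNReal.ofNat_ne_top ENNReal.coe_ne_top
  set J : ℝ≥0∞ := ⨆ z ∈ Metric.ball x ρ, N z F
  have hJ : ∀ z ∈ Metric.ball x ρ, N z F ≤ J := fun z hz =>
    le_iSup₂ (f := fun (z : V) (_ : z ∈ Metric.ball x ρ) => N z F) z hz
  have hJC : ∀ w ∈ Metric.ball x' ρ, J ≤ C * N w F := fun w hw => iSup₂_le fun z hz =>
    hNF z hz w hw
  have hup : reducedMeasure W x (Metric.ball x ρ)ᶜ F ≤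
      CN * (l (Metric.ball x ρ) * (CG * g ρ) * J) :=
    ((ENNReal.inv_mul_le_iff hCN0 ENNReal.coe_ne_top).1
      (hN.lower x ρ hρ (hle ρ (by linarith)) F hF hFx)).trans
      (mul_le_mul_right (setLIntegral_greenOn_mul_le hG hρ hGg hJ) _)
  -- The distances add up to less than `7ρ`; `8ρ` is used because it is three doublings of `ρ`.
  have hdw : ∀ w ∈ Metric.ball x' ρ, dist y w ≤ 8 * ρ := by
    intro w hw
    have h1 := Metric.mem_ball'.1 hw
    linarith [dist_triangle4 y x x' w]
  have hsub : Metric.ball x' ρ ⊆ Metric.ball y s := fun w hw =>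
    Metric.mem_ball'.2 ((hdw w hw).trans_lt (by linarith))
  have hlow : l (Metric.ball x ρ) * (g (8 * ρ) * J) ≤
      2 * c * C * (CN * reducedMeasure W y (Metric.ball y s)ᶜ F) := by
    calc l (Metric.ball x ρ) * (g (8 * ρ) * J)
        = ∫⁻ _ in Metric.ball x' ρ, g (8 * ρ) * J ∂l := by
          rw [setLIntegral_const, mul_comm, Measure.addHaar_ball_center l x,
            Measure.addHaar_ball_center l x']
      _ ≤ ∫⁻ w in Metric.ball x' ρ,
            2 * c * C * (greenOn W G (Metric.ball y s) y w * N w F) ∂l := by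
          refine setLIntegral_mono' measurableSet_ball fun w hw => ?_
          have h1 := (ENNReal.inv_mul_le_iff h2c0 h2ct).1
            (hG.le_greenOn_ball hW (by positivity) h8 hfin hgs (hdw w hw))
          calc g (8 * ρ) * J
              ≤ (2 * c * greenOn W G (Metric.ball y s) y w) * (C * N w F) :=
                mul_le_mul' h1 (hJC w hw)
            _ = _ := by ring
      _ ≤ ∫⁻ w in Metric.ball y s,
            2 * c * C * (greenOn W G (Metric.ball y s) y w * N w F) ∂l := lintegral_mono_set hsub
      _ = 2 * c * C * ∫⁻ w in Metric.ball y s, greenOn W G (Metric.ball y s) y w * N w F ∂l :=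
          lintegral_const_mul' _ _ (ENNReal.mul_ne_top h2ct ENNReal.coe_ne_top)
      _ ≤ 2 * c * C * (CN * reducedMeasure W y (Metric.ball y s)ᶜ F) := by
          gcongr
          exact hN.upper y s hs hsR F hF hFy
  have hdbl : g ρ ≤ (cD : ℝ≥0∞) ^ 3 * g (8 * ρ) := by
    have h := hG.iterate_doubling hρ 3 (hle _ (by linarith))
    rwa [show (2 : ℝ) ^ 3 = 8 by norm_num] at h
  calc reducedMeasure W x (Metric.ball x ρ)ᶜ F
      ≤ CN * (l (Metric.ball x ρ) * (CG * ((cD : ℝ≥0∞) ^ 3 * g (8 * ρ))) * J) := by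
        refine hup.trans ?_
        gcongr
    _ = CN * CG * (cD : ℝ≥0∞) ^ 3 * (l (Metric.ball x ρ) * (g (8 * ρ) * J)) := by ring
    _ ≤ CN * CG * (cD : ℝ≥0∞) ^ 3 *
          (2 * c * C * (CN * reducedMeasure W y (Metric.ball y s)ᶜ F)) := by gcongr
    _ = _ := by
        push_cast
        ring

theorem IkedaWatanabe.jumpCondition [Nontrivial V] (hN : IkedaWatanabe W G R₀ l N MN CN)
    (hW : IsBalayageSpace W) (hG : IsGreenFunction W G g c cD α₀ η₀ R₀) (hCG : 1 ≤ CG)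
    (hGg : ∀ (x : V) (r : ℝ), 0 < r → ENNReal.ofReal r < R₀ →
      (l (Metric.ball x r))⁻¹ * ∫⁻ z in Metric.ball x r, G x z ∂l ≤ (CG : ℝ≥0∞) * g r)
    {lt : Measure V} {n : V → V → ℝ≥0} (hn : ∀ y, Measurable (n y))
    (hNn : ∀ y, N y = lt.withDensity (fun z => (n y z : ℝ≥0∞))) (hC : 1 ≤ C) {a : ℝ} (ha : 0 ≤ a)
    (hdec : ∀ (x : V) (r : ℝ), 0 < r → ENNReal.ofReal r < R₀ →
      ∀ y ∈ Metric.ball x r, ∀ z ∈ (Metric.ball x (a * r))ᶜ,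
        dist y z ≤ dist x z → n x z ≤ C * n y z) :
    JumpCondition W := by
  have : ProperSpace V := FiniteDimensional.proper ℝ V
  have hsph : ∀ (x : V) (t : ℝ), 0 ≤ t → ∃ w, dist w x = t := fun x t ht =>
    (NormedSpace.sphere_nonempty (x := x)).2 ht
  obtain ⟨β, hβ0, hβ1, hβ⟩ := hG.exists_decay_const
  have hc := hG.one_le_c
  have hcD := hG.one_lt_cD
  have hCN := hN.one_le
  have hMN := hN.three_le
  -- The factor `16 * MN` yields `8ρ ≤ β (s / 2)`, hence the gap between `g (8ρ)` and `g (s / 2)`;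
  -- the factor `7 * a + 2` keeps `E` outside `B(z, 7aρ)` for all `z ∈ B(x,ρ)`.
  set D : ℝ := 16 * MN * (7 * a + 2) with hD
  have hDpos : 0 < D := by positivity
  have hDa : 96 * (7 * a + 2) ≤ 2 * D := by nlinarith
  have hDM : 32 * MN ≤ D := by nlinarith
  refine ⟨R₀, CN * CG * cD ^ 3 * (2 * c * C) * CN, β / D, hG.R₀_pos, by positivity,
    by positivity, ?_, ?_⟩
  · rw [div_lt_iff₀ hDpos]
    linarith
  intro x r hr hrR y hy E hE hEr
  set ρ := β / D * r with hρdef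
  have hρ : 0 < ρ := by positivity
  have hDρ : D * ρ = β * r := by
    rw [hρdef]
    field_simp
  have hDρr : D * ρ ≤ r := hDρ ▸ mul_le_of_le_one_left hr.le hβ1
  -- With `MN * s = r`, the upper Ikeda-Watanabe bound for `B(y,s)` holds on exactly `B(y,r)ᶜ`.
  set s := r / MN with hsdef
  have hMs : MN * s = r := by
    rw [hsdef]
    field_simp
  have hs : 0 < s := by positivity
  have hsr : s ≤ r := by nlinarith
  have hβs : 8 * ρ ≤ β * (s / 2) := by
    have h1 : 16 * MN * ρ ≤ β * r := by
      rw [← hDρ]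
      gcongr
      linarith
    rw [← hMs] at h1
    nlinarith
  have h8 : 8 * ρ ≤ s / 2 := hβs.trans (mul_le_of_le_one_left (by positivity) hβ1)
  have haρ : (7 * a + 2) * ρ ≤ r := by nlinarith
  have hMρ : (MN + 1) * ρ ≤ r := by nlinarith
  have h7R : ENNReal.ofReal (7 * ρ) < R₀ :=
    (ENNReal.ofReal_le_ofReal (by linarith)).trans_lt hrR
  have hsR : ENNReal.ofReal s < R₀ := (ENNReal.ofReal_le_ofReal hsr).trans_lt hrR
  have hgs : 2 * (c : ℝ≥0∞) ^ 2 * g (s / 2) ≤ g (8 * ρ) :=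
    (hβ (s / 2) (by positivity)
      ((ENNReal.ofReal_le_ofReal (by linarith)).trans_lt hrR)).trans
      (hG.g_antitone (mem_Ici.2 (by positivity)) (mem_Ici.2 (by positivity)) hβs)
  have hfin : g (8 * ρ) ≠ ∞ := by
    obtain ⟨w, hw⟩ := hsph x (8 * ρ) (by positivity)
    exact hG.ne_top_of_dist_eq (by positivity) hw
  have hyx : dist y x < ρ := hy
  have hEy : ∀ z ∈ E, r ≤ dist z y := fun z hz => not_lt.1 (hEr hz)
  have hEx : ∀ z ∈ E, r - ρ ≤ dist z x := fun z hz => by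
    linarith [hEy z hz, dist_triangle z x y, dist_comm x y]
  -- A pole outside the closed ball, so that the exit measures from `B(y,s)` and `B(y,r)` represent
  -- reduction.
  obtain ⟨w, hw⟩ := hsph y (r + 1) (by positivity)
  refine measure_le_mul_of_cover hE
    (S := fun i => {z | dist x (TopologicalSpace.denseSeq V i) < 5 * ρ ∧
      dist (TopologicalSpace.denseSeq V i) z + 2 * ρ < dist x z}) (fun i => ?_) (fun z hz => ?_)
    (fun i F hF hFE hFS => ?_)
  · exact (MeasurableSet.const _).inter
      (isOpen_lt ((continuous_const.dist continuous_id).add continuous_const)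
        (continuous_const.dist continuous_id)).measurableSet
  · rw [mem_iUnion]
    refine exists_denseSeq_closer hρ ?_
    rw [dist_comm]
    linarith [hEx z hz]
  rcases F.eq_empty_or_nonempty with rfl | ⟨z₀, hz₀⟩
  · simp
  refine (hN.reducedMeasure_le_of_closer (CG := CG) (C := C) hW hG hρ h8 hsR hfin hgs
    (hGg x ρ hρ ((ENNReal.ofReal_le_ofReal (by linarith)).trans_lt hrR)) hyx (hFS hz₀).1 hF
    (fun z hz => ?_) (hMs.symm ▸ hFE.trans hEr) (fun z hz w hw => ?_)).trans ?_
  · rw [mem_compl_iff, Metric.mem_ball, not_lt]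
    linarith [hEx z (hFE hz)]
  · have hz := Metric.mem_ball.1 hz
    have hw' := Metric.mem_ball'.1 hw
    -- The centre is `z`, and `7ρ = ρ + 5ρ + ρ` bounds `dist z w` through `x` and `x'`.
    refine withDensity_le_mul_of_closer hn hNn hdec (r := 7 * ρ) (by positivity) h7R ?_ hF
      (fun u hu => ?_) (fun u hu => ?_)
    · rw [Metric.mem_ball']
      linarith [dist_triangle4 z x (TopologicalSpace.denseSeq V i) w, (hFS hz₀).1]
    · rw [mem_compl_iff, Metric.mem_ball, not_lt]
      linarith [hEx u (hFE hu), dist_triangle u z x]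
    -- The margin `2ρ` absorbs the radii of the balls containing `z` and `w`.
    · have h1 := (hFS hu).2
      linarith [dist_triangle w (TopologicalSpace.denseSeq V i) u, dist_triangle x z u,
        dist_comm x z, dist_comm w (TopologicalSpace.denseSeq V i)]
  · exact mul_le_mul_right
      (hG.reducedMeasure_ball_le hW hs hsr (by linarith) hF (hFE.trans hEr)) _

end Jump

/-- Covers `d = 0`, where spheres of positive radius are empty but so is the complement of every
ball. -/
theorem jumpCondition_of_subsingleton {X : Type*} [MetricSpace X] [MeasurableSpace X]
    [Subsingleton X] (W : Set (X → ℝ≥0∞)) : JumpCondition W := by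
  refine ⟨1, 1, 1 / 4, one_pos, one_pos, by norm_num, by norm_num, fun x r hr _ y _ E _ hE => ?_⟩
  have h0 : E = ∅ := eq_empty_of_forall_notMem fun z hz =>
    hE hz (Subsingleton.elim y z ▸ Metric.mem_ball_self hr)
  simp [h0]

end Balayage

theorem proposition7p3 (d : ℕ)
    (W : Set (EuclideanSpace ℝ (Fin d) → ℝ≥0∞)) (hW : Balayage.IsBalayageSpace W)
    (G : EuclideanSpace ℝ (Fin d) → EuclideanSpace ℝ (Fin d) → ℝ≥0∞) (g : ℝ → ℝ≥0∞)
    (c cD : ℝ≥0) (α₀ : ℝ) (η₀ : ℝ≥0) (R₀ : ℝ≥0∞)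
    (hG : Balayage.IsGreenFunction W G g c cD α₀ η₀ R₀)
    (N : ProbabilityTheory.Kernel (EuclideanSpace ℝ (Fin d)) (EuclideanSpace ℝ (Fin d)))
    (MN : ℝ) (CN : ℝ≥0)
    (hN : Balayage.IkedaWatanabe W G R₀ volume N MN CN)
    (CG : ℝ≥0) (hCG : 1 ≤ CG)
    (hGg : ∀ (x : EuclideanSpace ℝ (Fin d)) (r : ℝ), 0 < r → ENNReal.ofReal r < R₀ →
      ∀ w : EuclideanSpace ℝ (Fin d),
        (volume (Metric.ball x r))⁻¹ * ∫⁻ z in Metric.ball x r, G w z ≤ (CG : ℝ≥0∞) * g r)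
    (lt : Measure (EuclideanSpace ℝ (Fin d)))
    (n : EuclideanSpace ℝ (Fin d) → EuclideanSpace ℝ (Fin d) → ℝ≥0)
    (hn : ∀ y, Measurable (n y))
    (hNn : ∀ y, N y = lt.withDensity (fun z => (n y z : ℝ≥0∞)))
    (C : ℝ≥0) (hC : 1 ≤ C) (a : ℝ) (ha : 3 ≤ a)
    (hdec : ∀ (x : EuclideanSpace ℝ (Fin d)) (r : ℝ), 0 < r → ENNReal.ofReal r < R₀ →
      ∀ y ∈ Metric.ball x r, ∀ z ∈ (Metric.ball x (a * r))ᶜ,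
        dist y z ≤ dist x z → n x z ≤ C * n y z) :
    Balayage.JumpCondition W := by
  rcases Nat.eq_zero_or_pos d with rfl | hd
  · exact Balayage.jumpCondition_of_subsingleton W
  · have : Nonempty (Fin d) := ⟨⟨0, hd⟩⟩
    exact hN.jumpCondition hW hG hCG (fun x r hr hrR => hGg x r hr hrR x) hn hNn hC
      (by linarith) hdec
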